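/- Let $(X,\mu)$ be a non-atomic measure space, i.e. every measurable set of positive measure has a measurable subset of smaller positive measure. For a measurable function $f$ on $X$ let $f^*(t)=\inf\{\alpha\ge 0:\mu(\{|f|>\alpha\})\le t\}$, and for $0<p<\infty$ let $\|f\|_{p,r}=\big(\frac rp\int_0^\infty [t^{1/p}f^*(t)]^r\frac{dt}{t}\big)^{1/r}$ if $0<r<\infty$ and $\|f\|_{p,\infty}=\sup_{t>0}t^{1/p}f^*(t)$. For a sequence $f=\{f_k\}$ of complex-valued measurable functions on $X$, indexed by a finite or countable set, put $$\|f\|_{L^{p,r}(\ell^q)}=\Big\|\Big(\sum_k|f_k|^q\Big)^{1/q}\Big\|_{p,r},\qquad \|f\|_{\ell^q(L^{p,r})}=\Big(\sum_k\|f_k\|_{p,r}^q\Big)^{1/q}$$ (with suprema over $k$ if $q=\infty$), and let $L^{p,r}(\ell^q)$ and $\ell^q(L^{p,r})$ be the spaces of those $f$ for which the respective quasi-norm is finite. Let $0<p<\infty$ and $0<q_0,q_1,r_0,r_1\le\infty$, with $r_0\le r_1$ and $q_1\ge\max\{p,q_0,r_0\}$. Then the embedding $$L^{p,r_0}(\ell^{q_0})\hookrightarrow\ell^{q_1}(L^{p,r_1})$$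 holds in each of the following three cases: (i) $p\ne q_0$; (ii) $p=q_0\le r_1$; (iii) $r_1<q_0=p<q_1$. That is, there is a finite constant $C$, depending only on $p,q_0,q_1,r_0,r_1$, such that every $f\in L^{p,r_0}(\ell^{q_0})$ belongs to $\ell^{q_1}(L^{p,r_1})$ and satisfies $\|f\|_{\ell^{q_1}(L^{p,r_1})}\le C\,\|f\|_{L^{p,r_0}(\ell^{q_0})}$. -/

import Mathlib

open MeasureTheory
open scoped ENNReal NNReal

noncomputable section

namespace LorentzSeq

/-- A measure is non-atomic if every (measurable) set of positive measure has a (measurable) subset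
of smaller positive measure. -/
def NonAtomic {X : Type*} [MeasurableSpace X] (μ : Measure X) : Prop :=
  ∀ s : Set X, MeasurableSet s → 0 < μ s → ∃ t ⊆ s, MeasurableSet t ∧ 0 < μ t ∧ μ t < μ s

/-- The distribution function `α ↦ μ {x | g x > α}` of a nonnegative function. -/
def distrib {X : Type*} [MeasurableSpace X] (μ : Measure X) (g : X → ℝ≥0∞) (α : ℝ≥0∞) : ℝ≥0∞ :=
  μ {x | α < g x}

/-- The nonincreasing rearrangement `g*(t) = inf {α ≥ 0 | μ {g > α} ≤ t}`. -/
def rearr {X : Type*} [MeasurableSpace X] (μ : Measure X) (g : X → ℝ≥0∞) (t : ℝ) : ℝ≥0∞ :=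
  sInf {α : ℝ≥0∞ | distrib μ g α ≤ ENNReal.ofReal t}

/-- The standard Lorentz quasi-norm of a nonnegative function `g`, for `0 < p < ∞`, `0 < r ≤ ∞`:
`((r/p) ∫₀^∞ [t^{1/p} g*(t)]^r dt/t)^{1/r}` if `r < ∞`, and `sup_{t>0} t^{1/p} g*(t)` if `r = ∞`. -/
def lorentzNorm {X : Type*} [MeasurableSpace X] (μ : Measure X) (p r : ℝ≥0∞)
    (g : X → ℝ≥0∞) : ℝ≥0∞ :=
  if r = ∞ then
    ⨆ (t : ℝ) (_ : 0 < t), ENNReal.ofReal t ^ (1 / p.toReal) * rearr μ g t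
  else
    (r / p * ∫⁻ t in Set.Ioi (0 : ℝ),
      (ENNReal.ofReal t ^ (1 / p.toReal) * rearr μ g t) ^ r.toReal / ENNReal.ofReal t)
        ^ (1 / r.toReal)

/-- The `ℓ^q` quasi-norm of a family of nonnegative extended reals, `0 < q ≤ ∞`. -/
def ellNorm {ι : Type*} (q : ℝ≥0∞) (a : ι → ℝ≥0∞) : ℝ≥0∞ :=
  if q = ∞ then ⨆ k, a k else (∑' k, a k ^ q.toReal) ^ (1 / q.toReal)

/-- The quasi-norm of `L^{p,r}(ℓ^q)`: the Lorentz quasi-norm of `x ↦ ‖(f_k(x))_k‖_{ℓ^q}`. -/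
def lorentzEllNorm {X ι : Type*} [MeasurableSpace X] (μ : Measure X) (p r q : ℝ≥0∞)
    (f : ι → X → ℂ) : ℝ≥0∞ :=
  lorentzNorm μ p r (fun x => ellNorm q (fun k => ‖f k x‖ₑ))

/-- The quasi-norm of `ℓ^q(L^{p,r})`: the `ℓ^q` quasi-norm of the Lorentz quasi-norms of `f_k`. -/
def ellLorentzNorm {X ι : Type*} [MeasurableSpace X] (μ : Measure X) (p r q : ℝ≥0∞)
    (f : ι → X → ℂ) : ℝ≥0∞ :=
  ellNorm q (fun k => lorentzNorm μ p r (fun x => ‖f k x‖ₑ))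

/-- Membership in `L^{p,r}(ℓ^q)`. -/
def MemLorentzEll {X ι : Type*} [MeasurableSpace X] (μ : Measure X) (p r q : ℝ≥0∞)
    (f : ι → X → ℂ) : Prop :=
  (∀ k, AEMeasurable (f k) μ) ∧ lorentzEllNorm μ p r q f < ∞

/-- Membership in `ℓ^q(L^{p,r})`. -/
def MemEllLorentz {X ι : Type*} [MeasurableSpace X] (μ : Measure X) (p r q : ℝ≥0∞)
    (f : ι → X → ℂ) : Prop :=
  (∀ k, AEMeasurable (f k) μ) ∧ ellLorentzNorm μ p r q f < ∞

end LorentzSeq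

end

namespace LorentzSeq

/-! ### Sums and integrals of extended nonnegative reals -/

/-! Write `g` for the pointwise `ℓ^{q₀}` norm of the sequence. Since `L^{p,r}` increases with `r`
(`exists_lorentzNorm_le`), it is mostly enough to work with `r₁ = r₀ = r ≤ q₁`. For `q₁ = ∞` the
bound is then `|f_k| ≤ g`. The remaining cases compare `q₁` with `p`.

If `p < q₁ < ∞`, enlarging `q₀` to `q₁` only decreases `g`. Removing `{g > g*(u)}` and applying
Chebyshev's inequality to each `f_k` gives `∑_k f_k*(2u)^q ≤ ∑_i 2^(i+1) g*(2^i u)^q`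
(`tsum_rearr_rpow_le`). Minkowski's inequality with exponent `q/r ≥ 1`, subadditivity of the power
`r/q` and scaling of `t^(r/p-1) dt` leave a geometric series of ratio `2^(r/q-r/p) < 1`.

If `q₀ < p = q₁`, use the equivalent dyadic quantity `∑_j 2^(jr) μ{g > 2^j}^(r/p)`. Counting the
indices with `|f_k| > 2^j` bounds `∑_k μ{|f_k| > 2^j}` by `∑_i 2^((i+1)q₀) μ{g > 2^(j+i)}`.
Minkowski with exponent `p/r`, now for sums over `j`, leads to a geometric series of ratio
`2^(q₀r/p-r) < 1`.

If `q₀ = p = q₁`, both series degenerate. The case hypotheses then force `r₀ ≤ p ≤ r₁`, and the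
embedding factors through `L^{p,p}(ℓ^p) = ℓ^p(L^{p,p})`, which is Tonelli's theorem. -/

lemma rpow_finset_sum_le {ι : Type*} (s : Finset ι) (b : ι → ℝ≥0∞) {θ : ℝ} (h0 : 0 < θ)
    (h1 : θ ≤ 1) : (∑ i ∈ s, b i) ^ θ ≤ ∑ i ∈ s, b i ^ θ := by
  classical
  induction s using Finset.induction_on with
  | empty => simp [h0]
  | insert a s ha ih =>
    rw [Finset.sum_insert ha, Finset.sum_insert ha]
    exact (ENNReal.rpow_add_le_add_rpow _ _ h0.le h1).trans (by gcongr)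

lemma rpow_tsum_le {ι : Type*} (b : ι → ℝ≥0∞) {θ : ℝ} (h0 : 0 < θ) (h1 : θ ≤ 1) :
    (∑' i, b i) ^ θ ≤ ∑' i, b i ^ θ := by
  rw [← ENNReal.le_rpow_inv_iff h0, ENNReal.tsum_eq_iSup_sum]
  refine iSup_le fun s => ?_
  rw [ENNReal.le_rpow_inv_iff h0]
  exact (rpow_finset_sum_le s b h0 h1).trans (ENNReal.sum_le_tsum s)

lemma ellNorm_of_ne_top {ι : Type*} {q : ℝ≥0∞} (hq : q ≠ ∞) (a : ι → ℝ≥0∞) :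
    ellNorm q a = (∑' k, a k ^ q.toReal) ^ (1 / q.toReal) := if_neg hq

lemma ellNorm_rpow {ι : Type*} {q : ℝ≥0∞} (hq0 : 0 < q) (hq : q ≠ ∞) (a : ι → ℝ≥0∞) :
    ellNorm q a ^ q.toReal = ∑' k, a k ^ q.toReal := by
  rw [ellNorm_of_ne_top hq, one_div, ENNReal.rpow_inv_rpow (ENNReal.toReal_pos hq0.ne' hq).ne']

lemma le_ellNorm {ι : Type*} {q : ℝ≥0∞} (hq : 0 < q) (a : ι → ℝ≥0∞) (k : ι) :
    a k ≤ ellNorm q a := by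
  by_cases h : q = ∞
  · rw [ellNorm, if_pos h]; exact le_iSup a k
  · have hq' := ENNReal.toReal_pos hq.ne' h
    rw [← ENNReal.rpow_le_rpow_iff hq', ellNorm_rpow hq h]
    exact ENNReal.le_tsum k

lemma ellNorm_mono {ι : Type*} {q : ℝ≥0∞} {a b : ι → ℝ≥0∞} (h : ∀ k, a k ≤ b k) :
    ellNorm q a ≤ ellNorm q b := by
  unfold ellNorm
  split_ifs
  · exact iSup_mono h
  · have := h; gcongr; exact h _

lemma ellNorm_const_mul {ι : Type*} {q : ℝ≥0∞} (hq0 : 0 < q) (hq : q ≠ ∞) (c : ℝ≥0∞)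
    (a : ι → ℝ≥0∞) : ellNorm q (fun k => c * a k) = c * ellNorm q a := by
  have hq' := ENNReal.toReal_pos hq0.ne' hq
  simp only [ellNorm_of_ne_top hq, ENNReal.mul_rpow_of_nonneg _ _ hq'.le]
  rw [ENNReal.tsum_mul_left, ENNReal.mul_rpow_of_nonneg _ _ (by positivity), one_div,
    ENNReal.rpow_rpow_inv hq'.ne']

lemma ellNorm_antitone {ι : Type*} {q q' : ℝ≥0∞} (hq : 0 < q) (h : q ≤ q') (hq' : q' ≠ ∞)
    (a : ι → ℝ≥0∞) : ellNorm q' a ≤ ellNorm q a := by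
  have hqt : q ≠ ∞ := ne_top_of_le_ne_top hq' h
  have h0 := ENNReal.toReal_pos hq.ne' hqt
  have h1 : q.toReal ≤ q'.toReal := ENNReal.toReal_mono hq' h
  have h2 := h0.trans_le h1
  rw [← ENNReal.rpow_le_rpow_iff h0, ellNorm_rpow hq hqt, ellNorm_of_ne_top hq', ← ENNReal.rpow_mul]
  refine (rpow_tsum_le _ (by positivity) ?_).trans_eq ?_
  · rw [one_div_mul_eq_div, div_le_one h2]; exact h1
  · congr with k
    rw [← ENNReal.rpow_mul]
    congr 1; field_simp

/-- Minkowski's integral inequality for finitely many functions. -/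
lemma finset_sum_lintegral_rpow_le {ι T : Type*} [MeasurableSpace T] (ν : Measure T)
    (S : Finset ι) (F : ι → T → ℝ≥0∞) (hF : ∀ k, Measurable (F k)) {s : ℝ} (hs : 1 ≤ s) :
    ∑ k ∈ S, (∫⁻ t, F k t ∂ν) ^ s ≤ (∫⁻ t, (∑ k ∈ S, F k t ^ s) ^ (1 / s) ∂ν) ^ s := by
  have hs0 : 0 < s := by linarith
  rcases hs.eq_or_lt with rfl | hs1
  · simp only [ENNReal.rpow_one, div_one]
    rw [lintegral_finsetSum _ fun k _ => hF k]
  -- The duality argument ends by cancelling a power of `A`, so infinite integrals are settled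
  -- first.
  by_cases hfin : ∃ k ∈ S, ∫⁻ t, F k t ∂ν = ∞
  · obtain ⟨k, hk, hkt⟩ := hfin
    have : ∫⁻ t, (∑ k ∈ S, F k t ^ s) ^ (1 / s) ∂ν = ∞ := by
      rw [← top_le_iff, ← hkt]
      refine lintegral_mono fun t => ?_
      rw [one_div, ENNReal.le_rpow_inv_iff hs0]
      exact Finset.single_le_sum (f := fun k => F k t ^ s) (fun _ _ => zero_le) hk
    rw [this, ENNReal.top_rpow_of_pos hs0]
    exact le_top
  push Not at hfin
  set I : ι → ℝ≥0∞ := fun k => ∫⁻ t, F k t ∂ν with hI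
  set A : ℝ≥0∞ := ∑ k ∈ S, I k ^ s with hA
  have hAt : A ≠ ∞ := ENNReal.sum_ne_top.2 fun k hk => ENNReal.rpow_ne_top_of_nonneg hs0.le (hfin k hk)
  by_cases hA0 : A = 0
  · rw [hA0]; exact zero_le
  have hconj : s.HolderConjugate (s / (s - 1)) := Real.HolderConjugate.conjExponent hs1
  -- Duality: write `I_k^s = I_k^(s-1) ∫ F_k`, move the sum under the integral, and apply Hölder in
  -- `k` with exponents `s` and `s/(s-1)`.
  have key : A ≤ A ^ (1 - 1 / s) * ∫⁻ t, (∑ k ∈ S, F k t ^ s) ^ (1 / s) ∂ν := by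
    calc A = ∑ k ∈ S, I k ^ (s - 1) * ∫⁻ t, F k t ∂ν := by
          refine Finset.sum_congr rfl fun k hk => ?_
          change _ = I k ^ (s - 1) * I k
          conv_rhs => rw [← ENNReal.rpow_one (I k), ← ENNReal.rpow_mul, one_mul]
          rw [← ENNReal.rpow_add_of_nonneg _ _ (by linarith) zero_le_one]
          congr 1; ring
      _ = ∫⁻ t, ∑ k ∈ S, F k t * I k ^ (s - 1) ∂ν := by
          rw [lintegral_finsetSum _ fun k _ => (hF k).mul_const _]
          refine Finset.sum_congr rfl fun k _ => ?_
          rw [lintegral_mul_const _ (hF k), mul_comm]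
      _ ≤ ∫⁻ t, (∑ k ∈ S, F k t ^ s) ^ (1 / s) * A ^ (1 - 1 / s) ∂ν := by
          refine lintegral_mono fun t => ?_
          refine (ENNReal.inner_le_Lp_mul_Lq S _ _ hconj).trans_eq ?_
          have e : ∀ k, (I k ^ (s - 1)) ^ (s / (s - 1)) = I k ^ s := fun k => by
            rw [← ENNReal.rpow_mul]; congr 1
            have : s - 1 ≠ 0 := by linarith
            field_simp
          simp only [e]
          congr 2
          have : s - 1 ≠ 0 := by linarith
          field_simp
      _ = _ := by
          rw [lintegral_mul_const, mul_comm]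
          exact (Finset.measurable_fun_sum _ fun k _ => (hF k).pow_const _).pow_const _
  set J := ∫⁻ t, (∑ k ∈ S, F k t ^ s) ^ (1 / s) ∂ν
  have h2 : A ^ (1 - 1 / s) * A ^ (1 / s) ≤ A ^ (1 - 1 / s) * J := by
    rw [← ENNReal.rpow_add _ _ hA0 hAt]; simpa using key
  have hne : A ^ (1 - 1 / s) ≠ 0 := (ENNReal.rpow_pos (pos_iff_ne_zero.2 hA0) hAt).ne'
  have hs' : 0 ≤ 1 - 1 / s := by
    rw [sub_nonneg, div_le_one hs0]; exact hs
  have h3 := (ENNReal.mul_le_mul_iff_right hne (ENNReal.rpow_ne_top_of_nonneg hs' hAt)).1 h2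
  rwa [one_div, ENNReal.rpow_inv_le_iff hs0] at h3

/-- Minkowski's integral inequality for a family of functions. -/
lemma tsum_lintegral_rpow_le {ι T : Type*} [MeasurableSpace T] (ν : Measure T)
    (F : ι → T → ℝ≥0∞) (hF : ∀ k, Measurable (F k)) {s : ℝ} (hs : 1 ≤ s) :
    ∑' k, (∫⁻ t, F k t ∂ν) ^ s ≤ (∫⁻ t, (∑' k, F k t ^ s) ^ (1 / s) ∂ν) ^ s := by
  rw [ENNReal.tsum_eq_iSup_sum]
  refine iSup_le fun S => (finset_sum_lintegral_rpow_le ν S F hF hs).trans ?_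
  gcongr
  exact ENNReal.sum_le_tsum S

/-! ### The measure `a t^(a-1) dt` on the half-line -/

/-- The measure `a t^(a-1) dt` on `(0, ∞)`. -/
noncomputable def powMeasure (a : ℝ) : Measure ℝ :=
  (volume.restrict (Set.Ioi 0)).withDensity fun t => ENNReal.ofReal (a * t ^ (a - 1))

lemma measurable_powDensity (a : ℝ) :
    Measurable fun t : ℝ => ENNReal.ofReal (a * t ^ (a - 1)) := by fun_prop

lemma lintegral_powMeasure (a : ℝ) {F : ℝ → ℝ≥0∞} (hF : Measurable F) :
    ∫⁻ t, F t ∂powMeasure a = ∫⁻ t in Set.Ioi 0, ENNReal.ofReal (a * t ^ (a - 1)) * F t := by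
  rw [powMeasure, lintegral_withDensity_eq_lintegral_mul _ (measurable_powDensity a) hF]
  rfl

lemma ae_powMeasure_pos (a : ℝ) : ∀ᵐ t ∂powMeasure a, 0 < t :=
  (withDensity_absolutelyContinuous _ _).ae_le (ae_restrict_mem measurableSet_Ioi)

lemma powMeasure_Iio {a D : ℝ} (ha : 0 < a) (hD : 0 ≤ D) :
    powMeasure a (Set.Iio D) = ENNReal.ofReal D ^ a := by
  rw [powMeasure, withDensity_apply _ measurableSet_Iio, Measure.restrict_restrict measurableSet_Iio,
    Set.inter_comm, Set.Ioi_inter_Iio, restrict_Ioo_eq_restrict_Ioc]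
  have hint : IntervalIntegrable (fun t : ℝ => a * t ^ (a - 1)) volume 0 D :=
    (intervalIntegral.intervalIntegrable_rpow' (by linarith)).const_mul a
  rw [← ofReal_integral_eq_lintegral_ofReal, ← intervalIntegral.integral_of_le hD,
    intervalIntegral.integral_const_mul, integral_rpow (Or.inl (by linarith)),
    ENNReal.ofReal_rpow_of_nonneg hD ha.le]
  · congr 1
    rw [sub_add_cancel, Real.zero_rpow ha.ne']; field_simp; ring
  · exact (intervalIntegrable_iff_integrableOn_Ioc_of_le hD).1 hint
  · refine (ae_restrict_mem measurableSet_Ioc).mono fun t ht => ?_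
    have := Real.rpow_nonneg ht.1.le (a - 1)
    change 0 ≤ _
    positivity

/-- With `a = r/p` this turns an integral over rearrangement levels into the power `r/p` of a
distribution function; the factor `a` in the density makes the constant exactly 1. -/
lemma powMeasure_ofReal_lt {a : ℝ} (ha : 0 < a) (d : ℝ≥0∞) :
    powMeasure a {t | ENNReal.ofReal t < d} = d ^ a := by
  by_cases hd : d = ∞
  · subst hd
    rw [ENNReal.top_rpow_of_pos ha, ← top_le_iff]
    refine ENNReal.le_of_forall_nnreal_lt fun r _ => ?_
    have : ENNReal.ofReal ((r : ℝ) ^ a⁻¹) ^ a = r := by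
      rw [ENNReal.ofReal_rpow_of_nonneg (by positivity) ha.le,
        Real.rpow_inv_rpow r.coe_nonneg ha.ne', ENNReal.ofReal_coe_nnreal]
    rw [← this, ← powMeasure_Iio ha (by positivity)]
    exact measure_mono fun t _ => ENNReal.ofReal_lt_top
  · by_cases hd0 : d = 0
    · simp [hd0, ha]
    have h := powMeasure_Iio ha (D := d.toReal) ENNReal.toReal_nonneg
    rw [ENNReal.ofReal_toReal hd] at h
    rw [← h]
    congr 1
    ext t
    change ENNReal.ofReal t < d ↔ t < d.toReal
    rw [← ENNReal.ofReal_lt_ofReal_iff (ENNReal.toReal_pos hd0 hd), ENNReal.ofReal_toReal hd]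

lemma lintegral_powMeasure_comp_mul (a : ℝ) {c : ℝ} (hc : 0 < c) {F : ℝ → ℝ≥0∞}
    (hF : Measurable F) :
    ∫⁻ t, F (c * t) ∂powMeasure a = ENNReal.ofReal c ^ (-a) * ∫⁻ t, F t ∂powMeasure a := by
  rw [lintegral_powMeasure a hF,
    lintegral_powMeasure a (F := fun t => F (c * t)) (hF.comp (measurable_const_mul c))]
  have hmap : Measure.map (c * ·) (volume.restrict (Set.Ioi (0 : ℝ)))
      = ENNReal.ofReal c⁻¹ • volume.restrict (Set.Ioi (0 : ℝ)) := by
    have h := Real.map_volume_mul_left hc.ne'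
    rw [abs_of_pos (inv_pos.2 hc)] at h
    rw [← Measure.restrict_smul, ← h, Measure.restrict_map (measurable_const_mul c) measurableSet_Ioi]
    congr 2
    ext t
    simp [hc]
  have hc0 : ENNReal.ofReal c ≠ 0 := by simpa using hc
  have h1 : ∀ t ∈ Set.Ioi (0 : ℝ), ENNReal.ofReal (a * t ^ (a - 1)) * F (c * t)
      = ENNReal.ofReal c ^ (1 - a) * (ENNReal.ofReal (a * (c * t) ^ (a - 1)) * F (c * t)) := by
    intro t ht
    rw [ENNReal.ofReal_rpow_of_pos hc, ← mul_assoc, ← ENNReal.ofReal_mul (by positivity)]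
    congr 2
    rw [Real.mul_rpow hc.le (le_of_lt ht)]
    have : c ^ (1 - a) * c ^ (a - 1) = 1 := by
      rw [← Real.rpow_add hc]; simp
    linear_combination (-(a * t ^ (a - 1))) * this
  have hm : Measurable fun t => ENNReal.ofReal (a * t ^ (a - 1)) * F t :=
    (measurable_powDensity a).mul hF
  have hmc : Measurable fun t => ENNReal.ofReal (a * (c * t) ^ (a - 1)) * F (c * t) :=
    hm.comp (measurable_const_mul c)
  have h2 := lintegral_map (μ := volume.restrict (Set.Ioi 0)) hm (measurable_const_mul c)
  rw [setLIntegral_congr_fun measurableSet_Ioi h1, lintegral_const_mul _ hmc, ← h2, hmap,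
    lintegral_smul_measure, smul_eq_mul, ← mul_assoc]
  congr 1
  rw [ENNReal.ofReal_inv_of_pos hc, ← ENNReal.rpow_neg_one,
    ← ENNReal.rpow_add _ _ hc0 ENNReal.ofReal_ne_top]
  congr 1; ring

/-! ### The nonincreasing rearrangement -/

section Rearr

variable {X : Type*} [MeasurableSpace X] {μ : Measure X} {h h' : X → ℝ≥0∞}

lemma distrib_anti (μ : Measure X) (h : X → ℝ≥0∞) {α β : ℝ≥0∞} (hab : α ≤ β) :
    distrib μ h β ≤ distrib μ h α :=
  measure_mono fun _ hx => lt_of_le_of_lt hab hx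

lemma distrib_mono (hh : ∀ x, h x ≤ h' x) (α : ℝ≥0∞) : distrib μ h α ≤ distrib μ h' α :=
  measure_mono fun x hx => lt_of_lt_of_le hx (hh x)

lemma rearr_antitone (μ : Measure X) (h : X → ℝ≥0∞) : Antitone (rearr μ h) := fun _ _ hst =>
  sInf_le_sInf fun _ hα => le_trans hα (ENNReal.ofReal_le_ofReal hst)

lemma measurable_rearr (μ : Measure X) (h : X → ℝ≥0∞) : Measurable (rearr μ h) :=
  (rearr_antitone μ h).measurable

lemma rearr_mono (hh : ∀ x, h x ≤ h' x) (t : ℝ) : rearr μ h t ≤ rearr μ h' t :=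
  sInf_le_sInf fun α hα => (distrib_mono hh α).trans hα

lemma lt_distrib_of_lt_rearr {α : ℝ≥0∞} {t : ℝ} (hα : α < rearr μ h t) :
    ENNReal.ofReal t < distrib μ h α := by
  by_contra hc
  exact absurd (sInf_le (show α ∈ {α | distrib μ h α ≤ ENNReal.ofReal t} from not_lt.1 hc))
    (not_le.2 hα)

lemma le_rearr_of_lt_distrib {α : ℝ≥0∞} {t : ℝ} (hα : ENNReal.ofReal t < distrib μ h α) :
    α ≤ rearr μ h t := by
  refine le_sInf fun β hβ => ?_
  by_contra hc
  exact absurd ((distrib_anti μ h (not_le.1 hc).le).trans hβ) (not_le.2 hα)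

/-- The infimum defining `g*(t)` is attained: along a sequence decreasing to it the superlevel sets
increase to `{h > h*(t)}`, and continuity from below holds without measurability. -/
lemma distrib_rearr_le (μ : Measure X) (h : X → ℝ≥0∞) (t : ℝ) :
    distrib μ h (rearr μ h t) ≤ ENNReal.ofReal t := by
  have hne : {α : ℝ≥0∞ | distrib μ h α ≤ ENNReal.ofReal t}.Nonempty :=
    ⟨∞, by change distrib μ h ∞ ≤ _; simp [distrib]⟩
  obtain ⟨u, hu, hlim, hmem⟩ := exists_seq_tendsto_sInf hne (OrderBot.bddBelow _)
  have hset : {x | rearr μ h t < h x} = ⋃ n, {x | u n < h x} := by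
    ext x
    rw [Set.mem_iUnion]
    constructor
    · intro hx
      exact ((hlim.eventually (gt_mem_nhds hx)).exists)
    · rintro ⟨n, hn⟩
      exact lt_of_le_of_lt (sInf_le (hmem n)) hn
  have hmono : Monotone fun n => {x | u n < h x} := fun m n hmn x hx =>
    lt_of_le_of_lt (hu hmn) hx
  rw [distrib, hset, hmono.measure_iUnion]
  exact iSup_le hmem

lemma rearr_congr_ae (hh : h =ᵐ[μ] h') : rearr μ h = rearr μ h' := by
  have : distrib μ h = distrib μ h' := by
    funext α
    refine measure_congr ?_
    filter_upwards [hh] with x hx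
    change (α < h x) = (α < h' x)
    rw [hx]
  funext t
  rw [rearr, rearr, this]

/-! ### The Lorentz quasi-norm -/

lemma lorentzNorm_congr_ae {p r : ℝ≥0∞} (hh : h =ᵐ[μ] h') :
    lorentzNorm μ p r h = lorentzNorm μ p r h' := by
  rw [lorentzNorm, lorentzNorm, rearr_congr_ae hh]

lemma lorentzNorm_mono {p r : ℝ≥0∞} (hh : ∀ x, h x ≤ h' x) :
    lorentzNorm μ p r h ≤ lorentzNorm μ p r h' := by
  have := rearr_mono (μ := μ) hh
  unfold lorentzNorm
  split_ifs
  · gcongr; exact this _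
  · gcongr; exact this _

/-- The weight `t^(r/p) dt/t` and the normalization `r/p` are absorbed into `powMeasure`. -/
lemma lorentzNorm_rpow {p r : ℝ≥0∞} (hp : 0 < p) (hp' : p ≠ ∞) (hr : 0 < r) (hr' : r ≠ ∞) :
    lorentzNorm μ p r h ^ r.toReal
      = ∫⁻ t, rearr μ h t ^ r.toReal ∂powMeasure (r.toReal / p.toReal) := by
  have hP := ENNReal.toReal_pos hp.ne' hp'
  have hR := ENNReal.toReal_pos hr.ne' hr'
  have hm : Measurable fun t => rearr μ h t ^ r.toReal := (measurable_rearr μ h).pow_const _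
  rw [lorentzNorm, if_neg hr', one_div r.toReal, ENNReal.rpow_inv_rpow hR.ne', lintegral_powMeasure _ hm,
    ← lintegral_const_mul']
  swap
  · exact ENNReal.div_ne_top hr' hp.ne'
  refine setLIntegral_congr_fun measurableSet_Ioi fun t ht => ?_
  have ht0 : 0 < t := ht
  have ht1 : ENNReal.ofReal t ≠ 0 := by simpa using ht0
  have e : r / p = ENNReal.ofReal (r.toReal / p.toReal) := by
    rw [ENNReal.ofReal_div_of_pos hP, ENNReal.ofReal_toReal hr', ENNReal.ofReal_toReal hp']
  rw [ENNReal.mul_rpow_of_nonneg _ _ hR.le, ← ENNReal.rpow_mul, e, div_eq_mul_inv (_ * _),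
    ENNReal.ofReal_mul (by positivity), ← ENNReal.ofReal_rpow_of_pos ht0,
    ENNReal.rpow_sub _ _ ht1 ENNReal.ofReal_ne_top, ENNReal.rpow_one, div_eq_mul_inv (_ ^ _),
    one_div_mul_eq_div]
  ring

/-- On `(0, t)`, of mass `t^(r/p)`, the rearrangement is at least its value at `t`. -/
lemma rearr_le_lorentzNorm {p r : ℝ≥0∞} (hp : 0 < p) (hp' : p ≠ ∞) (hr : 0 < r) (hr' : r ≠ ∞)
    (t : ℝ) : ENNReal.ofReal t ^ (1 / p.toReal) * rearr μ h t ≤ lorentzNorm μ p r h := by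
  have hP := ENNReal.toReal_pos hp.ne' hp'
  have hR := ENNReal.toReal_pos hr.ne' hr'
  have ha : 0 < r.toReal / p.toReal := by positivity
  rw [← ENNReal.rpow_le_rpow_iff hR, lorentzNorm_rpow hp hp' hr hr',
    ENNReal.mul_rpow_of_nonneg _ _ hR.le, ← ENNReal.rpow_mul, one_div_mul_eq_div,
    ← powMeasure_ofReal_lt ha, mul_comm]
  have hs : MeasurableSet {s : ℝ | ENNReal.ofReal s < ENNReal.ofReal t} :=
    measurableSet_lt ENNReal.measurable_ofReal measurable_const
  rw [← setLIntegral_const]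
  refine le_trans (setLIntegral_mono' hs fun s hst => ?_) (setLIntegral_le_lintegral _ _)
  have : s ≤ t := (lt_of_not_ge fun hts => absurd (ENNReal.ofReal_le_ofReal hts) (not_le.2 hst)).le
  gcongr
  exact rearr_antitone μ h this

/-- The spaces `L^{p,r}` increase with `r`. -/
lemma exists_lorentzNorm_le {p r₀ r₁ : ℝ≥0∞} (hp : 0 < p) (hp' : p ≠ ∞) (hr₀ : 0 < r₀)
    (hr : r₀ ≤ r₁) : ∃ C : ℝ≥0, ∀ (X : Type*) [MeasurableSpace X] (μ : Measure X) (h : X → ℝ≥0∞),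
      lorentzNorm μ p r₁ h ≤ C * lorentzNorm μ p r₀ h := by
  rcases eq_or_ne r₀ r₁ with rfl | hne
  · exact ⟨1, fun X _ μ h => by simp⟩
  have hr₀' : r₀ ≠ ∞ := (lt_of_le_of_ne hr hne).ne_top
  by_cases hr₁' : r₁ = ∞
  · refine ⟨1, fun X _ μ h => ?_⟩
    rw [lorentzNorm, if_pos hr₁', ENNReal.coe_one, one_mul]
    exact iSup₂_le fun t _ => rearr_le_lorentzNorm hp hp' hr₀ hr₀' t
  have hr₁ : 0 < r₁ := hr₀.trans_le hr
  have hP := ENNReal.toReal_pos hp.ne' hp'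
  have hR₀ := ENNReal.toReal_pos hr₀.ne' hr₀'
  have hR₁ := ENNReal.toReal_pos hr₁.ne' hr₁'
  have hR : r₀.toReal ≤ r₁.toReal := ENNReal.toReal_mono hr₁' hr
  refine ⟨(Real.toNNReal (r₁.toReal / r₀.toReal)) ^ (1 / r₁.toReal), fun X _ μ h => ?_⟩
  set N := lorentzNorm μ p r₀ h with hN
  rw [← ENNReal.rpow_le_rpow_iff hR₁, lorentzNorm_rpow hp hp' hr₁ hr₁',
    ENNReal.mul_rpow_of_nonneg _ _ hR₁.le, ENNReal.coe_rpow_of_nonneg _ (by positivity), one_div,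
    ENNReal.rpow_inv_rpow hR₁.ne']
  have hm : ∀ s : ℝ, Measurable fun t => rearr μ h t ^ s := fun s => (measurable_rearr μ h).pow_const _
  have e : N ^ r₁.toReal = N ^ (r₁.toReal - r₀.toReal) * N ^ r₀.toReal := by
    rw [← ENNReal.rpow_add_of_nonneg _ _ (by linarith) hR₀.le]; congr 1; ring
  rw [e, lorentzNorm_rpow hp hp' hr₀ hr₀', lintegral_powMeasure _ (hm _),
    lintegral_powMeasure _ (hm _), ← mul_assoc, ← lintegral_const_mul _
      (f := fun t => ENNReal.ofReal (_ * t ^ (_ - 1)) * rearr μ h t ^ _)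
      ((measurable_powDensity _).mul (hm _))]
  refine setLIntegral_mono' measurableSet_Ioi fun t ht => ?_
  have ht0 : 0 < t := ht
  have ht1 : ENNReal.ofReal t ≠ 0 := by simpa using ht0
  -- Split off `r₁ - r₀` powers of `t^(1/p) h*(t)` and bound them by powers of `N`; the rest is the
  -- `r₀` integrand.
  have h1 := ENNReal.rpow_le_rpow (rearr_le_lorentzNorm (μ := μ) (h := h) hp hp' hr₀ hr₀' t)
    (sub_nonneg.2 hR)
  rw [← hN, ENNReal.mul_rpow_of_nonneg _ _ (sub_nonneg.2 hR), ← ENNReal.rpow_mul] at h1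
  have e2 : rearr μ h t ^ r₁.toReal
      = rearr μ h t ^ (r₁.toReal - r₀.toReal) * rearr μ h t ^ r₀.toReal := by
    rw [← ENNReal.rpow_add_of_nonneg _ _ (by linarith) hR₀.le]; congr 1; ring
  have e3 : ENNReal.ofReal (r₁.toReal / p.toReal * t ^ (r₁.toReal / p.toReal - 1))
      = ENNReal.ofReal (r₁.toReal / r₀.toReal) *
        ENNReal.ofReal (r₀.toReal / p.toReal * t ^ (r₀.toReal / p.toReal - 1)) *
        ENNReal.ofReal t ^ (1 / p.toReal * (r₁.toReal - r₀.toReal)) := by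
    rw [ENNReal.ofReal_rpow_of_pos ht0, ← ENNReal.ofReal_mul (by positivity),
      ← ENNReal.ofReal_mul (by positivity)]
    congr 1
    have : t ^ (r₁.toReal / p.toReal - 1) = t ^ (r₀.toReal / p.toReal - 1) *
        t ^ (1 / p.toReal * (r₁.toReal - r₀.toReal)) := by
      rw [← Real.rpow_add ht0]; congr 1; field_simp; ring
    rw [this]; field_simp
  rw [e2, e3]
  calc _ = ENNReal.ofReal (r₁.toReal / r₀.toReal) *
          (ENNReal.ofReal t ^ (1 / p.toReal * (r₁.toReal - r₀.toReal)) *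
            rearr μ h t ^ (r₁.toReal - r₀.toReal)) *
          (ENNReal.ofReal (r₀.toReal / p.toReal * t ^ (r₀.toReal / p.toReal - 1)) *
            rearr μ h t ^ r₀.toReal) := by ring
    _ ≤ _ := by gcongr; exact le_rfl

end Rearr

/-! ### Dyadic sums -/

open Classical in
/-- The value `1` if `P` holds and `0` otherwise. -/
noncomputable def truthValue (P : Prop) : ℝ≥0∞ := if P then 1 else 0

lemma truthValue_of {P : Prop} (h : P) : truthValue P = 1 := if_pos h

lemma truthValue_of_not {P : Prop} (h : ¬P) : truthValue P = 0 := if_neg h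

lemma truthValue_le_one (P : Prop) : truthValue P ≤ 1 := by
  unfold truthValue; split_ifs <;> simp

lemma truthValue_mono {P Q : Prop} (h : P → Q) : truthValue P ≤ truthValue Q := by
  by_cases hP : P
  · rw [truthValue_of hP, truthValue_of (h hP)]
  · rw [truthValue_of_not hP]; exact zero_le

lemma truthValue_eq_indicator {X : Type*} (P : X → Prop) :
    (fun x => truthValue (P x)) = {x | P x}.indicator 1 := by
  classical
  funext x
  rw [Set.indicator_apply]
  by_cases h : P x
  · rw [truthValue_of h, if_pos (show x ∈ {x | P x} from h), Pi.one_apply]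
  · rw [truthValue_of_not h, if_neg (show x ∉ {x | P x} from h)]

lemma measurable_truthValue {X : Type*} [MeasurableSpace X] {P : X → Prop}
    (hP : MeasurableSet {x | P x}) : Measurable fun x => truthValue (P x) := by
  rw [truthValue_eq_indicator]; exact measurable_one.indicator hP

lemma lintegral_truthValue {X : Type*} [MeasurableSpace X] (μ : Measure X) {P : X → Prop}
    (hP : MeasurableSet {x | P x}) : ∫⁻ x, truthValue (P x) ∂μ = μ {x | P x} := by
  rw [truthValue_eq_indicator, lintegral_indicator_one hP]

lemma two_rpow_ne_zero (x : ℝ) : (2 : ℝ≥0∞) ^ x ≠ 0 :=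
  (ENNReal.rpow_pos (by norm_num) (by norm_num)).ne'

lemma two_rpow_ne_top (x : ℝ) : (2 : ℝ≥0∞) ^ x ≠ ∞ := by
  rw [Ne, ENNReal.rpow_eq_top_iff]; norm_num

lemma two_rpow_add (x y : ℝ) : (2 : ℝ≥0∞) ^ (x + y) = 2 ^ x * 2 ^ y :=
  ENNReal.rpow_add _ _ (by norm_num) (by norm_num)

lemma two_rpow_le {x y : ℝ} (h : x ≤ y) : (2 : ℝ≥0∞) ^ x ≤ 2 ^ y :=
  ENNReal.rpow_le_rpow_of_exponent_le (by norm_num) h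

lemma two_rpow_lt_iff {x y : ℝ} : (2 : ℝ≥0∞) ^ x < 2 ^ y ↔ x < y := by
  refine ⟨fun h => ?_, fun h => ENNReal.rpow_lt_rpow_of_exponent_lt (by norm_num) (by norm_num) h⟩
  by_contra hc
  exact absurd h (not_lt.2 (two_rpow_le (not_lt.1 hc)))

lemma tsum_two_rpow_ne_top {x : ℝ} (hx : x < 0) : ∑' n : ℕ, (2 : ℝ≥0∞) ^ (n * x) ≠ ∞ := by
  have : ∀ n : ℕ, (2 : ℝ≥0∞) ^ (n * x) = (2 ^ x) ^ n := fun n => by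
    rw [mul_comm, ENNReal.rpow_mul, ENNReal.rpow_natCast]
  simp only [this, ENNReal.tsum_geometric]
  rw [Ne, ENNReal.inv_eq_top, tsub_eq_zero_iff_le, not_le]
  exact ENNReal.rpow_lt_one_of_one_lt_of_neg (by norm_num) hx

lemma dyadicConst_ne_top {R : ℝ} (hR : 0 < R) :
    (2 : ℝ≥0∞) ^ R * ∑' n : ℕ, (2 : ℝ≥0∞) ^ (n * (-R)) ≠ ∞ :=
  ENNReal.mul_ne_top (two_rpow_ne_top _) (tsum_two_rpow_ne_top (by linarith))

lemma exists_two_rpow_lt_le {y : ℝ≥0∞} (h0 : y ≠ 0) (ht : y ≠ ∞) :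
    ∃ j : ℤ, (2 : ℝ≥0∞) ^ (j : ℝ) < y ∧ y ≤ 2 ^ ((j : ℝ) + 1) := by
  obtain ⟨j, hj, hj'⟩ := ENNReal.exists_mem_Ioc_zpow h0 ht (by norm_num : (1 : ℝ≥0∞) < 2) (by norm_num)
  refine ⟨j, ?_, ?_⟩
  · rwa [ENNReal.rpow_intCast]
  · have : ((j : ℝ) + 1) = ((j + 1 : ℤ) : ℝ) := by push_cast; ring
    rwa [this, ENNReal.rpow_intCast]

/-- The value of `y ^ R` beyond a dyadic level is controlled by the dyadic levels below `y`. -/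
lemma rpow_le_tsum_nat {R : ℝ} (hR : 0 < R) {y : ℝ≥0∞} {j : ℤ} (hj : (2 : ℝ≥0∞) ^ (j : ℝ) < y) :
    y ^ R ≤ ∑' i : ℕ, 2 ^ (((j + i : ℤ) + 1 : ℝ) * R) *
      truthValue (2 ^ ((j + i : ℤ) : ℝ) < y) := by
  -- At `y = ∞` no top dyadic level exists, but every term is bounded below by one positive
  -- constant, so the series diverges.
  by_cases ht : y = ∞
  · subst ht
    have : ∀ i : ℕ, (2 : ℝ≥0∞) ^ (((j : ℝ) + 1) * R) ≤ 2 ^ (((j + i : ℤ) + 1 : ℝ) * R) *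
      truthValue (2 ^ ((j + i : ℤ) : ℝ) < ∞) := fun i => by
      rw [truthValue_of (two_rpow_ne_top _).lt_top, mul_one]
      apply two_rpow_le
      push_cast
      nlinarith [(Nat.cast_nonneg i : (0 : ℝ) ≤ i)]
    refine le_trans ?_ (ENNReal.tsum_le_tsum this)
    rw [ENNReal.tsum_const_eq_top_of_ne_zero (two_rpow_ne_zero _)]
    exact le_top
  · obtain ⟨m, hm, hm'⟩ := exists_two_rpow_lt_le (ne_bot_of_gt hj) ht
    have hjm : (j : ℝ) < (m : ℝ) + 1 := two_rpow_lt_iff.1 (hj.trans_le hm')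
    have hjm' : j < m + 1 := by exact_mod_cast hjm
    obtain ⟨i, hi⟩ := Int.le.dest (Int.lt_add_one_iff.1 hjm')
    refine le_trans ?_ (ENNReal.le_tsum i)
    rw [hi, truthValue_of hm, mul_one,
      ENNReal.rpow_mul]
    gcongr

lemma rpow_le_tsum_int {R : ℝ} (hR : 0 < R) (y : ℝ≥0∞) :
    y ^ R ≤ 2 ^ R * ∑' j : ℤ, 2 ^ ((j : ℝ) * R) *
      truthValue (2 ^ (j : ℝ) < y) := by
  by_cases h0 : y = 0
  · simp [h0, hR]
  rw [← ENNReal.tsum_mul_left]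
  have e : ∀ j : ℤ, (2 : ℝ≥0∞) ^ R * (2 ^ ((j : ℝ) * R) *
      truthValue (2 ^ (j : ℝ) < y))
      = 2 ^ ((j + 1 : ℝ) * R) * truthValue (2 ^ (j : ℝ) < y) := fun j => by
    rw [← mul_assoc, ← two_rpow_add]; congr 2; ring
  simp only [e]
  obtain ⟨j, hj⟩ : ∃ j : ℤ, (2 : ℝ≥0∞) ^ (j : ℝ) < y := by
    by_cases ht : y = ∞
    · exact ⟨0, by simp [ht]⟩
    · exact (exists_two_rpow_lt_le h0 ht).imp fun _ h => h.1
  refine (rpow_le_tsum_nat hR hj).trans ?_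
  exact ENNReal.tsum_comp_le_tsum_of_injective (f := fun i : ℕ => j + (i : ℤ))
    (fun a b hab => by simpa using hab)
    (fun j : ℤ => (2 : ℝ≥0∞) ^ ((j + 1 : ℝ) * R) * truthValue (2 ^ (j : ℝ) < y))

/-- The levels below `y` form a geometric series dominated by its top term. The test is `≤` here but
`<` in `rpow_le_tsum_int`, to match the two implications between `distrib` and `rearr`. -/
lemma tsum_int_le_rpow {R : ℝ} (hR : 0 < R) (y : ℝ≥0∞) :
    ∑' j : ℤ, 2 ^ ((j : ℝ) * R) * truthValue (2 ^ (j : ℝ) ≤ y)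
      ≤ (2 ^ R * ∑' n : ℕ, 2 ^ (n * (-R))) * y ^ R := by
  by_cases h0 : y = 0
  · have : ∀ j : ℤ, truthValue ((2 : ℝ≥0∞) ^ (j : ℝ) ≤ y) = 0 := fun j =>
      truthValue_of_not fun h => by
        rw [h0] at h; exact two_rpow_ne_zero _ (le_zero_iff.1 h)
    simp only [this, mul_zero, tsum_zero]; exact zero_le
  by_cases ht : y = ∞
  · rw [ht, ENNReal.top_rpow_of_pos hR, ENNReal.mul_top]
    · exact le_top
    · refine mul_ne_zero (two_rpow_ne_zero _) fun h => ?_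
      exact two_rpow_ne_zero _ (ENNReal.tsum_eq_zero.1 h 0)
  obtain ⟨m, hm, hm'⟩ := exists_two_rpow_lt_le h0 ht
  have hinj : Function.Injective fun n : ℕ => m + 1 - (n : ℤ) := fun a b hab => by simpa using hab
  have hsupp : (Function.support fun j : ℤ => (2 : ℝ≥0∞) ^ ((j : ℝ) * R) *
      truthValue (2 ^ (j : ℝ) ≤ y)) ⊆ Set.range fun n : ℕ => m + 1 - (n : ℤ) := by
    intro j hj
    have hmem : (2 : ℝ≥0∞) ^ (j : ℝ) ≤ y := by
      by_contra hc
      exact hj (by simp only [truthValue_of_not hc, mul_zero])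
    have h1 : (j : ℝ) ≤ (m : ℝ) + 1 := by
      by_contra hc
      exact absurd (le_trans hmem hm') (not_le.2 (two_rpow_lt_iff.2 (not_le.1 hc)))
    have h2 : j ≤ m + 1 := by exact_mod_cast h1
    obtain ⟨n, hn⟩ := Int.le.dest h2
    exact ⟨n, by simp only; omega⟩
  rw [← hinj.tsum_eq hsupp, mul_comm (2 ^ R), mul_assoc, ← ENNReal.tsum_mul_right]
  refine ENNReal.tsum_le_tsum fun n => ?_
  calc _ ≤ (2 : ℝ≥0∞) ^ (((m + 1 - (n : ℤ) : ℤ) : ℝ) * R) * 1 := by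
        gcongr
        exact truthValue_le_one _
    _ = 2 ^ (n * (-R)) * (2 ^ R * (2 ^ (m : ℝ)) ^ R) := by
        rw [mul_one, ← ENNReal.rpow_mul, ← two_rpow_add, ← two_rpow_add]
        congr 1; push_cast; ring
    _ ≤ _ := by gcongr

/-! ### The dyadic form of the Lorentz quasi-norm -/

section

variable {X : Type*} [MeasurableSpace X] {μ : Measure X} {h : X → ℝ≥0∞}

lemma tsum_distrib_eq_lintegral (μ : Measure X) (h : X → ℝ≥0∞) (R : ℝ) {a : ℝ} (ha : 0 < a) :
    ∑' j : ℤ, (2 : ℝ≥0∞) ^ ((j : ℝ) * R) * distrib μ h (2 ^ (j : ℝ)) ^ a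
      = ∫⁻ t, ∑' j : ℤ, 2 ^ ((j : ℝ) * R) *
        truthValue (ENNReal.ofReal t < distrib μ h (2 ^ (j : ℝ))) ∂powMeasure a := by
  have hs : ∀ d : ℝ≥0∞, MeasurableSet {s : ℝ | ENNReal.ofReal s < d} := fun d =>
    measurableSet_lt ENNReal.measurable_ofReal measurable_const
  rw [lintegral_tsum fun j => ((measurable_truthValue (hs _)).const_mul _).aemeasurable]
  congr with j
  rw [lintegral_const_mul' _ _ (two_rpow_ne_top _), lintegral_truthValue _ (hs _),
    powMeasure_ofReal_lt ha]

lemma lorentzNorm_rpow_le_dyadic {p r : ℝ≥0∞} (hp : 0 < p) (hp' : p ≠ ∞) (hr : 0 < r)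
    (hr' : r ≠ ∞) :
    lorentzNorm μ p r h ^ r.toReal ≤ 2 ^ r.toReal *
      ∑' j : ℤ, 2 ^ ((j : ℝ) * r.toReal) * distrib μ h (2 ^ (j : ℝ)) ^ (r.toReal / p.toReal) := by
  have hP := ENNReal.toReal_pos hp.ne' hp'
  have hR := ENNReal.toReal_pos hr.ne' hr'
  rw [tsum_distrib_eq_lintegral μ h _ (by positivity), lorentzNorm_rpow hp hp' hr hr',
    ← lintegral_const_mul' _ _ (two_rpow_ne_top _)]
  refine lintegral_mono fun t => (rpow_le_tsum_int hR _).trans ?_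
  gcongr with j
  exact truthValue_mono lt_distrib_of_lt_rearr

lemma dyadic_le_lorentzNorm_rpow {p r : ℝ≥0∞} (hp : 0 < p) (hp' : p ≠ ∞) (hr : 0 < r)
    (hr' : r ≠ ∞) :
    ∑' j : ℤ, 2 ^ ((j : ℝ) * r.toReal) * distrib μ h (2 ^ (j : ℝ)) ^ (r.toReal / p.toReal)
      ≤ (2 ^ r.toReal * ∑' n : ℕ, 2 ^ (n * (-r.toReal))) * lorentzNorm μ p r h ^ r.toReal := by
  have hP := ENNReal.toReal_pos hp.ne' hp'
  have hR := ENNReal.toReal_pos hr.ne' hr'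
  rw [tsum_distrib_eq_lintegral μ h _ (by positivity), lorentzNorm_rpow hp hp' hr hr',
    ← lintegral_const_mul' _ _ (dyadicConst_ne_top hR)]
  refine lintegral_mono fun t => le_trans ?_ (tsum_int_le_rpow hR _)
  gcongr with j
  exact truthValue_mono le_rearr_of_lt_distrib

end

/-! ### Embeddings of mixed Lorentz sequence spaces -/

section

variable {X ι : Type*} [MeasurableSpace X] {μ : Measure X}

/-- The common last step of the three core estimates: extracting a root gives a constant depending
only on `K` and `R`. -/
lemma ellNorm_le_of_tsum_rpow_le {q : ℝ≥0∞} (hq0 : 0 < q) (hq : q ≠ ∞) {R : ℝ} (hR : 0 < R)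
    {a : ι → ℝ≥0∞} {K N : ℝ≥0∞} (hK : K ≠ ∞)
    (h : ∑' k, a k ^ q.toReal ≤ (K * N ^ R) ^ (q.toReal / R)) :
    ellNorm q a ≤ (K ^ (1 / R)).toNNReal * N := by
  have hQ := ENNReal.toReal_pos hq0.ne' hq
  rw [ENNReal.coe_toNNReal (ENNReal.rpow_ne_top_of_nonneg (by positivity) hK),
    ← ENNReal.rpow_le_rpow_iff hQ, ellNorm_rpow hq0 hq]
  refine h.trans_eq ?_
  rw [ENNReal.mul_rpow_of_nonneg _ _ (by positivity), ENNReal.mul_rpow_of_nonneg _ _ hQ.le,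
    ← ENNReal.rpow_mul, ← ENNReal.rpow_mul]
  congr 2 <;> field_simp

lemma measurable_ellNorm [Countable ι] {q : ℝ≥0∞} (hq : q ≠ ∞) {F : ι → X → ℝ≥0∞}
    (hF : ∀ k, Measurable (F k)) : Measurable fun x => ellNorm q fun k => F k x := by
  simp only [ellNorm_of_ne_top hq]
  exact (Measurable.tsum fun k => (hF k).pow_const _).pow_const _

/-- Chebyshev's inequality for the rearrangement, off a set of small measure. -/
lemma ofReal_mul_rearr_rpow_le {f : X → ℝ≥0∞} (hf : Measurable f) {A : Set X} {u Q : ℝ}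
    (hu : 0 < u) (hQ : 0 < Q) (hA : μ A ≤ ENNReal.ofReal u) :
    ENNReal.ofReal u * rearr μ f (2 * u) ^ Q ≤ ∫⁻ x in Aᶜ, f x ^ Q ∂μ := by
  have hu0 : ENNReal.ofReal u ≠ 0 := by simpa using hu
  rw [mul_comm, ← ENNReal.le_div_iff_mul_le (Or.inl hu0) (Or.inl ENNReal.ofReal_ne_top),
    ← ENNReal.le_rpow_inv_iff hQ]
  refine le_of_forall_lt_imp_le_of_dense fun α hα => ?_
  rw [ENNReal.le_rpow_inv_iff hQ, ENNReal.le_div_iff_mul_le (Or.inl hu0)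
    (Or.inl ENNReal.ofReal_ne_top)]
  -- More than `2u` of mass lies above `α`, so at least `u` of it survives the removal of `A`.
  have h1 : ENNReal.ofReal u + ENNReal.ofReal u < distrib μ f α := by
    rw [← ENNReal.ofReal_add hu.le hu.le, ← two_mul]
    exact lt_distrib_of_lt_rearr hα
  have h2 : distrib μ f α ≤ μ ({x | α < f x} ∩ Aᶜ) + μ A := by
    refine (measure_mono ?_).trans (measure_union_le _ _)
    intro x hx
    by_cases hxA : x ∈ A
    · exact Or.inr hxA
    · exact Or.inl ⟨hx, hxA⟩
  have h3 : ENNReal.ofReal u ≤ μ ({x | α < f x} ∩ Aᶜ) := by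
    by_contra hc
    exact absurd (h1.trans_le h2) (not_lt.2 (add_le_add (not_le.1 hc).le hA))
  calc α ^ Q * ENNReal.ofReal u ≤ α ^ Q * μ.restrict Aᶜ {x | α ^ Q ≤ f x ^ Q} := by
        gcongr
        refine h3.trans ((Measure.le_restrict_apply _ _).trans (measure_mono fun x hx => ?_))
        exact ENNReal.rpow_le_rpow (le_of_lt hx) hQ.le
    _ ≤ _ := mul_meas_ge_le_lintegral₀ (hf.pow_const _).aemeasurable _

/-- Off `{g > g*(u)}`, summing Chebyshev over `k` leaves `∫ g^Q`, which is cut along the levels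
`g*(2^i u)`: the part above `g*(2^(i+1) u)` has measure at most `2^(i+1) u`. The hypothesis `hlim`
puts every point with `g > 0` above some level. -/
lemma tsum_rearr_rpow_le [Countable ι] {F : ι → X → ℝ≥0∞} (hF : ∀ k, Measurable (F k))
    {g : X → ℝ≥0∞} (hg : Measurable g) {Q : ℝ} (hQ : 0 < Q)
    (hFg : ∀ x, ∑' k, F k x ^ Q = g x ^ Q) {u : ℝ} (hu : 0 < u)
    (hlim : ∀ ε : ℝ≥0∞, ε ≠ 0 → ∃ n : ℕ, rearr μ g (2 ^ n * u) < ε) :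
    ∑' k, rearr μ (F k) (2 * u) ^ Q
      ≤ ∑' i : ℕ, 2 ^ ((i : ℝ) + 1) * rearr μ g (2 ^ i * u) ^ Q := by
  have hu0 : ENNReal.ofReal u ≠ 0 := by simpa using hu
  have hms : ∀ α : ℝ≥0∞, MeasurableSet {x | α < g x} := fun α => measurableSet_lt measurable_const hg
  set A := {x | rearr μ g u < g x} with hAdef
  have hA : μ A ≤ ENNReal.ofReal u := distrib_rearr_le μ g u
  rw [← ENNReal.mul_le_mul_iff_right hu0 ENNReal.ofReal_ne_top, ← ENNReal.tsum_mul_left]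
  calc ∑' k, ENNReal.ofReal u * rearr μ (F k) (2 * u) ^ Q
      ≤ ∑' k, ∫⁻ x in Aᶜ, F k x ^ Q ∂μ :=
        ENNReal.tsum_le_tsum fun k => ofReal_mul_rearr_rpow_le (hF k) hu hQ hA
    _ = ∫⁻ x in Aᶜ, g x ^ Q ∂μ := by
        rw [← lintegral_tsum fun k => ((hF k).pow_const _).aemeasurable]
        simp only [hFg]
    _ ≤ ∫⁻ x in Aᶜ, ∑' i : ℕ, rearr μ g (2 ^ i * u) ^ Q *
          truthValue (rearr μ g (2 ^ (i + 1) * u) < g x) ∂μ := by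
        refine setLIntegral_mono' (hms _).compl fun x hx => ?_
        have hx' : g x ≤ rearr μ g u := not_lt.1 hx
        by_cases h0 : g x = 0
        · rw [h0, ENNReal.zero_rpow_of_pos hQ]; exact zero_le
        classical
        have hex := hlim (g x) h0
        -- The first level below `g x` is not level 0, because `x` lies outside `A`.
        obtain ⟨i, hi⟩ : ∃ i, Nat.find hex = i + 1 := by
          refine Nat.exists_eq_succ_of_ne_zero fun h => ?_
          have := Nat.find_spec hex
          rw [h, pow_zero, one_mul] at this
          exact absurd this (not_lt.2 hx')
        have h1 := Nat.find_spec hex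
        rw [hi] at h1
        have h2 := Nat.find_min hex (m := i) (by omega)
        refine le_trans ?_ (ENNReal.le_tsum i)
        rw [truthValue_of h1, mul_one]
        exact ENNReal.rpow_le_rpow (not_lt.1 h2) hQ.le
    _ ≤ ∫⁻ x, ∑' i : ℕ, rearr μ g (2 ^ i * u) ^ Q *
          truthValue (rearr μ g (2 ^ (i + 1) * u) < g x) ∂μ := setLIntegral_le_lintegral _ _
    _ = ∑' i : ℕ, rearr μ g (2 ^ i * u) ^ Q * distrib μ g (rearr μ g (2 ^ (i + 1) * u)) := by
        rw [lintegral_tsum fun i => ((measurable_truthValue (hms _)).const_mul _).aemeasurable]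
        congr with i
        rw [lintegral_const_mul _ (measurable_truthValue (hms _)), lintegral_truthValue _ (hms _)]
        rfl
    _ ≤ ∑' i : ℕ, rearr μ g (2 ^ i * u) ^ Q * ENNReal.ofReal (2 ^ (i + 1) * u) := by
        gcongr
        exact distrib_rearr_le _ _ _
    _ = ENNReal.ofReal u * ∑' i : ℕ, 2 ^ ((i : ℝ) + 1) * rearr μ g (2 ^ i * u) ^ Q := by
        rw [← ENNReal.tsum_mul_left]
        congr with i
        have : ((i : ℝ) + 1) = ((i + 1 : ℕ) : ℝ) := by push_cast; ring
        rw [ENNReal.ofReal_mul (by positivity), ENNReal.ofReal_pow (by norm_num), this,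
          ENNReal.rpow_natCast, ENNReal.ofReal_ofNat]
        ring

/-- A finite quasi-norm `N` forces `g*` to tend to 0: `g*(t) ≥ ε` implies `t ≤ (N/ε)^p`. -/
lemma exists_rearr_lt {p r : ℝ≥0∞} (hp : 0 < p) (hp' : p ≠ ∞) (hr : 0 < r) (hr' : r ≠ ∞)
    {g : X → ℝ≥0∞} (hN : lorentzNorm μ p r g ≠ ∞) {u : ℝ} (hu : 0 < u) {ε : ℝ≥0∞} (hε : ε ≠ 0) :
    ∃ n : ℕ, rearr μ g (2 ^ n * u) < ε := by
  have hP := ENNReal.toReal_pos hp.ne' hp'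
  by_contra! hc
  have hM : (lorentzNorm μ p r g / ε) ^ p.toReal ≠ ∞ :=
    ENNReal.rpow_ne_top_of_nonneg hP.le (ENNReal.div_ne_top hN hε)
  set M := (lorentzNorm μ p r g / ε) ^ p.toReal
  obtain ⟨n, hn⟩ := pow_unbounded_of_one_lt (M.toReal / u) (by norm_num : (1 : ℝ) < 2)
  have h1 : ENNReal.ofReal (2 ^ n * u) ≤ M := by
    rw [← ENNReal.rpow_inv_le_iff hP, ← one_div,
      ENNReal.le_div_iff_mul_le (Or.inl hε) (Or.inr hN)]
    refine le_trans ?_ (rearr_le_lorentzNorm hp hp' hr hr' (2 ^ n * u))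
    gcongr
    exact hc n
  have h2 := (ENNReal.ofReal_le_iff_le_toReal hM).1 h1
  rw [div_lt_iff₀ hu] at hn
  linarith

end

/-- If `p < q` and `r ≤ q`, then `L^{p,r}(ℓ^q)` embeds into `ℓ^q(L^{p,r})`. -/
lemma exists_ellNorm_lorentzNorm_le_of_lt {p q r : ℝ≥0∞} (hp : 0 < p) (hr : 0 < r) (hpq : p < q)
    (hrq : r ≤ q) (hq : q ≠ ∞) : ∃ C : ℝ≥0, ∀ (X : Type*) [MeasurableSpace X] (μ : Measure X)
      (ι : Type*) [Countable ι] (F : ι → X → ℝ≥0∞), (∀ k, Measurable (F k)) →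
        lorentzNorm μ p r (fun x => ellNorm q fun k => F k x) ≠ ∞ →
        ellNorm q (fun k => lorentzNorm μ p r (F k))
          ≤ C * lorentzNorm μ p r (fun x => ellNorm q fun k => F k x) := by
  have hp' : p ≠ ∞ := hpq.ne_top
  have hr' : r ≠ ∞ := ne_top_of_le_ne_top hq hrq
  have hq0 : 0 < q := hp.trans hpq
  have hP := ENNReal.toReal_pos hp.ne' hp'
  have hR := ENNReal.toReal_pos hr.ne' hr'
  have hQ := ENNReal.toReal_pos hq0.ne' hq
  have hRQ : r.toReal ≤ q.toReal := ENNReal.toReal_mono hq hrq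
  have hPQ : p.toReal < q.toReal := (ENNReal.toReal_lt_toReal hp' hq).2 hpq
  set P := p.toReal
  set Q := q.toReal
  set R := r.toReal with hRdef
  -- The `i`th term is `2^((i+1)R/Q)` from the level sum times `2^(-(i-1)R/P)` from the dilation by
  -- `2^i/2`; the series converges since `P < Q`.
  set K : ℝ≥0∞ := 2 ^ (R / Q + R / P) * ∑' i : ℕ, (2 : ℝ≥0∞) ^ (i * (R / Q - R / P)) with hKdef
  have hK : K ≠ ∞ := by
    refine ENNReal.mul_ne_top (two_rpow_ne_top _) (tsum_two_rpow_ne_top ?_)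
    rw [sub_neg]
    exact div_lt_div_of_pos_left hR hP hPQ
  refine ⟨(K ^ (1 / R)).toNNReal, fun X _ μ ι _ F hF hN => ?_⟩
  have hg := measurable_ellNorm hq hF
  have hFg : ∀ x, ∑' k, F k x ^ Q = (ellNorm q fun k => F k x) ^ Q := fun x =>
    (ellNorm_rpow hq0 hq _).symm
  set g : X → ℝ≥0∞ := fun x => ellNorm q fun k => F k x
  have hm : ∀ (h : X → ℝ≥0∞) (s : ℝ), Measurable fun t => rearr μ h t ^ s := fun h s =>
    (measurable_rearr μ h).pow_const _
  refine ellNorm_le_of_tsum_rpow_le hq0 hq hR hK ?_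
  have e1 : ∀ k, lorentzNorm μ p r (F k) ^ Q
      = (∫⁻ t, rearr μ (F k) t ^ R ∂powMeasure (R / P)) ^ (Q / R) := fun k => by
    rw [← lorentzNorm_rpow hp hp' hr hr', ← ENNReal.rpow_mul, mul_div_cancel₀ _ hR.ne']
  have hQR : 1 ≤ Q / R := (one_le_div hR).2 hRQ
  simp only [← hRdef] at *
  calc ∑' k, lorentzNorm μ p r (F k) ^ Q
      = ∑' k, (∫⁻ t, rearr μ (F k) t ^ R ∂powMeasure (R / P)) ^ (Q / R) := by simp only [e1]
    _ ≤ (∫⁻ t, (∑' k, (rearr μ (F k) t ^ R) ^ (Q / R)) ^ (1 / (Q / R)) ∂powMeasure (R / P))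
          ^ (Q / R) := tsum_lintegral_rpow_le _ _ (fun k => hm _ _) hQR
    _ ≤ (∫⁻ t, ∑' i : ℕ, 2 ^ ((i + 1 : ℝ) * (R / Q)) * rearr μ g ((2 ^ i / 2) * t) ^ R
          ∂powMeasure (R / P)) ^ (Q / R) := by
        refine ENNReal.rpow_le_rpow (lintegral_mono_ae ?_) (by positivity)
        filter_upwards [ae_powMeasure_pos (R / P)] with t ht
        have e2 : ∀ k, (rearr μ (F k) t ^ R) ^ (Q / R) = rearr μ (F k) (2 * (t / 2)) ^ Q := fun k => by
          rw [← ENNReal.rpow_mul, mul_div_cancel₀ _ hR.ne', mul_div_cancel₀ _ two_ne_zero]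
        simp only [e2, one_div_div]
        have h1 := tsum_rearr_rpow_le hF hg hQ hFg (half_pos ht)
          fun ε hε => exists_rearr_lt hp hp' hr hr' hN (half_pos ht) hε
        refine (ENNReal.rpow_le_rpow h1 (by positivity)).trans ?_
        refine (rpow_tsum_le _ (by positivity) ((div_le_one hQ).2 hRQ)).trans_eq ?_
        congr with i
        rw [ENNReal.mul_rpow_of_nonneg _ _ (by positivity), ← ENNReal.rpow_mul, ← ENNReal.rpow_mul,
          mul_div_cancel₀ _ hQ.ne']
        congr 3
        ring
    _ = (K * lorentzNorm μ p r g ^ R) ^ (Q / R) := by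
        congr 1
        have hm' : ∀ i : ℕ, Measurable fun t => rearr μ g ((2 ^ i / 2) * t) ^ R := fun i =>
          (hm g R).comp (measurable_const_mul _)
        rw [lintegral_tsum fun i => ((hm' i).const_mul _).aemeasurable, hKdef,
          ← ENNReal.tsum_mul_left, ← ENNReal.tsum_mul_right]
        congr with i
        rw [lintegral_const_mul _ (hm' i),
          lintegral_powMeasure_comp_mul _ (F := fun t => rearr μ g t ^ R) (by positivity) (hm g R),
          ← lorentzNorm_rpow hp hp' hr hr', ← mul_assoc]
        congr 1
        have e3 : ENNReal.ofReal (2 ^ i / 2) = 2 ^ ((i : ℝ) - 1) := by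
          rw [ENNReal.ofReal_div_of_pos (by norm_num), ENNReal.ofReal_pow (by norm_num),
            ENNReal.rpow_sub _ _ (by norm_num) (by norm_num), ENNReal.rpow_natCast,
            ENNReal.rpow_one, ENNReal.ofReal_ofNat]
        rw [e3, ← ENNReal.rpow_mul, ← two_rpow_add, ← two_rpow_add]
        congr 1
        ring

/-- If `q < p` and `r ≤ p`, then `L^{p,r}(ℓ^q)` embeds into `ℓ^p(L^{p,r})`. -/
lemma exists_ellNorm_lorentzNorm_le_of_gt {p q r : ℝ≥0∞} (hp' : p ≠ ∞) (hq : 0 < q) (hr : 0 < r)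
    (hqp : q < p) (hrp : r ≤ p) : ∃ C : ℝ≥0, ∀ (X : Type*) [MeasurableSpace X] (μ : Measure X)
      (ι : Type*) [Countable ι] (F : ι → X → ℝ≥0∞), (∀ k, Measurable (F k)) →
        ellNorm p (fun k => lorentzNorm μ p r (F k))
          ≤ C * lorentzNorm μ p r (fun x => ellNorm q fun k => F k x) := by
  have hp : 0 < p := hq.trans hqp
  have hq' : q ≠ ∞ := hqp.ne_top
  have hr' : r ≠ ∞ := ne_top_of_le_ne_top hp' hrp
  have hP := ENNReal.toReal_pos hp.ne' hp'
  have hR := ENNReal.toReal_pos hr.ne' hr'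
  have hQ := ENNReal.toReal_pos hq.ne' hq'
  have hRP : r.toReal ≤ p.toReal := ENNReal.toReal_mono hp' hrp
  have hQP : q.toReal < p.toReal := (ENNReal.toReal_lt_toReal hq' hp').2 hqp
  set D : ℝ≥0∞ := 2 ^ r.toReal * ∑' n : ℕ, (2 : ℝ≥0∞) ^ (n * (-r.toReal)) with hD
  have hDt : D ≠ ∞ := dyadicConst_ne_top hR
  -- `2^R` and `D` are the dyadic comparison constants; the series collects `2^((i+1)QR/P)` from
  -- counting and `2^(-iR)` from shifting `j` by `i`, and converges since `Q < P`.
  set K : ℝ≥0∞ := 2 ^ r.toReal * (2 ^ (q.toReal * (r.toReal / p.toReal)) *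
    (∑' i : ℕ, (2 : ℝ≥0∞) ^ (i * (q.toReal * (r.toReal / p.toReal) - r.toReal))) * D) with hKdef
  have hK : K ≠ ∞ := by
    refine ENNReal.mul_ne_top (two_rpow_ne_top _) (ENNReal.mul_ne_top (ENNReal.mul_ne_top
      (two_rpow_ne_top _) (tsum_two_rpow_ne_top ?_)) hDt)
    have : q.toReal * (r.toReal / p.toReal) = r.toReal * (q.toReal / p.toReal) := by ring
    rw [sub_neg, this]
    exact mul_lt_of_lt_one_right hR ((div_lt_one hP).2 hQP)
  refine ⟨(K ^ (1 / r.toReal)).toNNReal, fun X _ μ ι _ F hF => ?_⟩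
  have hg := measurable_ellNorm hq' hF
  have hFg : ∀ x, ∑' k, F k x ^ q.toReal = (ellNorm q fun k => F k x) ^ q.toReal := fun x =>
    (ellNorm_rpow hq hq' _).symm
  have hFle : ∀ x k, F k x ≤ ellNorm q fun k => F k x := fun x k =>
    le_ellNorm hq (fun k => F k x) k
  set g : X → ℝ≥0∞ := fun x => ellNorm q fun k => F k x
  set P := p.toReal
  set Q := q.toReal
  set R := r.toReal with hRdef
  have hRP1 : R / P ≤ 1 := (div_le_one hP).2 hRP
  have hms : ∀ {h : X → ℝ≥0∞} (_ : Measurable h) (α : ℝ≥0∞), MeasurableSet {x | α < h x} :=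
    fun hh α => measurableSet_lt measurable_const hh
  refine ellNorm_le_of_tsum_rpow_le hp hp' hR hK ?_
  -- At each point at most `2^(-jQ) g^Q` indices satisfy `F k x > 2^j`, and none unless `g > 2^j`;
  -- then `g^Q` is expanded over the levels from `j` upwards.
  have hcount : ∀ j : ℤ, ∑' k, distrib μ (F k) (2 ^ (j : ℝ))
      ≤ ∑' i : ℕ, 2 ^ ((i + 1 : ℝ) * Q) * distrib μ g (2 ^ ((j + i : ℤ) : ℝ)) := by
    intro j
    have e1 : ∀ k, distrib μ (F k) (2 ^ (j : ℝ)) = ∫⁻ x, truthValue (2 ^ (j : ℝ) < F k x) ∂μ :=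
      fun k => (lintegral_truthValue μ (hms (hF k) _)).symm
    have e2 : ∀ i : ℕ, (2 : ℝ≥0∞) ^ ((i + 1 : ℝ) * Q) * distrib μ g (2 ^ ((j + i : ℤ) : ℝ))
        = ∫⁻ x, 2 ^ ((i + 1 : ℝ) * Q) * truthValue (2 ^ ((j + i : ℤ) : ℝ) < g x) ∂μ := fun i => by
      rw [lintegral_const_mul' _ _ (two_rpow_ne_top _), lintegral_truthValue μ (hms hg _)]
      rfl
    simp only [e1, e2]
    rw [← lintegral_tsum fun k => (measurable_truthValue (hms (hF k) _)).aemeasurable,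
      ← lintegral_tsum fun i => ((measurable_truthValue (hms hg _)).const_mul _).aemeasurable]
    refine lintegral_mono fun x => ?_
    by_cases hx : 2 ^ (j : ℝ) < g x
    · rw [← ENNReal.mul_le_mul_iff_right (two_rpow_ne_zero (j * Q)) (two_rpow_ne_top _),
        ← ENNReal.tsum_mul_left, ← ENNReal.tsum_mul_left]
      calc ∑' k, (2 : ℝ≥0∞) ^ (j * Q) * truthValue (2 ^ (j : ℝ) < F k x)
          ≤ ∑' k, F k x ^ Q := by
            refine ENNReal.tsum_le_tsum fun k => ?_
            by_cases hk : 2 ^ (j : ℝ) < F k x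
            · rw [truthValue_of hk, mul_one, ENNReal.rpow_mul]
              exact ENNReal.rpow_le_rpow hk.le hQ.le
            · rw [truthValue_of_not hk, mul_zero]; exact zero_le
        _ = g x ^ Q := hFg x
        _ ≤ _ := rpow_le_tsum_nat hQ hx
        _ = _ := by
            congr with i
            rw [← mul_assoc, ← two_rpow_add]
            congr 2
            push_cast; ring
    · have : ∀ k, truthValue (2 ^ (j : ℝ) < F k x) = 0 := fun k =>
        truthValue_of_not fun hk => hx (hk.trans_le (hFle x k))
      simp only [this, tsum_zero]
      exact zero_le
  have hPR : 1 ≤ P / R := (one_le_div hR).2 hRP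
  -- The sum over `j` is written as an integral for counting measure so that the same Minkowski
  -- inequality applies.
  have hdy : ∀ k, lorentzNorm μ p r (F k) ^ P ≤ (2 ^ R) ^ (P / R) *
      (∫⁻ j : ℤ, 2 ^ ((j : ℝ) * R) * distrib μ (F k) (2 ^ (j : ℝ)) ^ (R / P) ∂Measure.count)
        ^ (P / R) := fun k => by
    rw [lintegral_count, ← ENNReal.mul_rpow_of_nonneg _ _ (by positivity)]
    have := ENNReal.rpow_le_rpow (lorentzNorm_rpow_le_dyadic (μ := μ) (h := F k) hp hp' hr hr')
      (show 0 ≤ P / R by positivity)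
    rwa [← ENNReal.rpow_mul, mul_div_cancel₀ _ hR.ne'] at this
  calc ∑' k, lorentzNorm μ p r (F k) ^ P
      ≤ (2 ^ R) ^ (P / R) * ∑' k,
        (∫⁻ j : ℤ, 2 ^ ((j : ℝ) * R) * distrib μ (F k) (2 ^ (j : ℝ)) ^ (R / P) ∂Measure.count)
        ^ (P / R) := by
        rw [← ENNReal.tsum_mul_left]
        exact ENNReal.tsum_le_tsum hdy
    _ ≤ (2 ^ R) ^ (P / R) * (∫⁻ j : ℤ, (∑' k,
        (2 ^ ((j : ℝ) * R) * distrib μ (F k) (2 ^ (j : ℝ)) ^ (R / P)) ^ (P / R)) ^ (1 / (P / R))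
          ∂Measure.count) ^ (P / R) := by
        gcongr
        exact tsum_lintegral_rpow_le _ _ (fun k => measurable_from_top) hPR
    _ = (2 ^ R * ∑' j : ℤ, 2 ^ ((j : ℝ) * R) *
          (∑' k, distrib μ (F k) (2 ^ (j : ℝ))) ^ (R / P)) ^ (P / R) := by
        rw [ENNReal.mul_rpow_of_nonneg _ _ (by positivity), lintegral_count]
        congr 3 with j
        have e : ∀ k, ((2 : ℝ≥0∞) ^ ((j : ℝ) * R) * distrib μ (F k) (2 ^ (j : ℝ)) ^ (R / P)) ^ (P / R)
            = 2 ^ ((j : ℝ) * P) * distrib μ (F k) (2 ^ (j : ℝ)) := fun k => by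
          rw [ENNReal.mul_rpow_of_nonneg _ _ (by positivity), ← ENNReal.rpow_mul,
            ← ENNReal.rpow_mul]
          have h1 : R / P * (P / R) = 1 := by field_simp
          have h2 : (j : ℝ) * R * (P / R) = j * P := by field_simp
          rw [h1, h2, ENNReal.rpow_one]
        simp only [e, one_div_div]
        rw [ENNReal.tsum_mul_left, ENNReal.mul_rpow_of_nonneg _ _ (by positivity),
          ← ENNReal.rpow_mul]
        congr 2
        field_simp
    _ ≤ (2 ^ R * ∑' j : ℤ, 2 ^ ((j : ℝ) * R) * ∑' i : ℕ, 2 ^ ((i + 1 : ℝ) * Q * (R / P)) *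
          distrib μ g (2 ^ ((j + i : ℤ) : ℝ)) ^ (R / P)) ^ (P / R) := by
        gcongr with j
        refine (ENNReal.rpow_le_rpow (hcount j) (by positivity)).trans ?_
        refine (rpow_tsum_le _ (by positivity) hRP1).trans_eq ?_
        congr with i
        rw [ENNReal.mul_rpow_of_nonneg _ _ (by positivity), ← ENNReal.rpow_mul]
    _ = (2 ^ R * ∑' i : ℕ, 2 ^ ((i + 1 : ℝ) * Q * (R / P) - i * R) * ∑' j : ℤ, 2 ^ ((j : ℝ) * R) *
          distrib μ g (2 ^ (j : ℝ)) ^ (R / P)) ^ (P / R) := by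
        simp only [← ENNReal.tsum_mul_left]
        rw [ENNReal.tsum_comm]
        congr with i
        rw [← (Equiv.addRight (i : ℤ)).tsum_eq fun j : ℤ =>
          (2 : ℝ≥0∞) ^ R * (2 ^ ((i + 1 : ℝ) * Q * (R / P) - i * R) * (2 ^ ((j : ℝ) * R) *
            distrib μ g (2 ^ (j : ℝ)) ^ (R / P)))]
        congr 1 with j
        congr 1
        change _ = _ * ((2 : ℝ≥0∞) ^ (((j + i : ℤ) : ℝ) * R) * distrib μ g (2 ^ ((j + i : ℤ) : ℝ)) ^ _)
        rw [← mul_assoc, ← two_rpow_add, ← mul_assoc, ← two_rpow_add]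
        congr 2
        push_cast; ring
    _ ≤ (2 ^ R * ∑' i : ℕ, 2 ^ ((i + 1 : ℝ) * Q * (R / P) - i * R) *
          (D * lorentzNorm μ p r g ^ R)) ^ (P / R) := by
        gcongr
        exact dyadic_le_lorentzNorm_rpow hp hp' hr hr'
    _ = (K * lorentzNorm μ p r g ^ R) ^ (P / R) := by
        congr 1
        rw [ENNReal.tsum_mul_right, hKdef, ← ENNReal.tsum_mul_left (a := 2 ^ (Q * (R / P)))]
        have e : ∀ i : ℕ, (2 : ℝ≥0∞) ^ ((i + 1 : ℝ) * Q * (R / P) - i * R)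
            = 2 ^ (Q * (R / P)) * 2 ^ (i * (Q * (R / P) - R)) := fun i => by
          rw [← two_rpow_add]; congr 1; ring
        simp only [e]
        ring

/-- The identity of `L^p(ℓ^p)` and `ℓ^p(L^p)`, up to constants. -/
lemma exists_ellNorm_lorentzNorm_le_of_eq {p : ℝ≥0∞} (hp : 0 < p) (hp' : p ≠ ∞) :
    ∃ C : ℝ≥0, ∀ (X : Type*) [MeasurableSpace X] (μ : Measure X)
      (ι : Type*) [Countable ι] (F : ι → X → ℝ≥0∞), (∀ k, Measurable (F k)) →
        ellNorm p (fun k => lorentzNorm μ p p (F k))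
          ≤ C * lorentzNorm μ p p (fun x => ellNorm p fun k => F k x) := by
  have hP := ENNReal.toReal_pos hp.ne' hp'
  set D : ℝ≥0∞ := 2 ^ p.toReal * ∑' n : ℕ, (2 : ℝ≥0∞) ^ (n * (-p.toReal)) with hD
  have hDt : D ≠ ∞ := dyadicConst_ne_top hP
  have hK : 2 ^ p.toReal * (D * (2 ^ p.toReal * D)) ≠ ∞ :=
    ENNReal.mul_ne_top (two_rpow_ne_top _) (ENNReal.mul_ne_top hDt
      (ENNReal.mul_ne_top (two_rpow_ne_top _) hDt))
  refine ⟨((2 ^ p.toReal * (D * (2 ^ p.toReal * D))) ^ (1 / p.toReal)).toNNReal,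
    fun X _ μ ι _ F hF => ellNorm_le_of_tsum_rpow_le hp hp' hP hK ?_⟩
  have hg := measurable_ellNorm hp' hF
  have hFg : ∀ x, ∑' k, F k x ^ p.toReal = (ellNorm p fun k => F k x) ^ p.toReal := fun x =>
    (ellNorm_rpow hp hp' _).symm
  set g : X → ℝ≥0∞ := fun x => ellNorm p fun k => F k x
  have hms : ∀ {h : X → ℝ≥0∞} (_ : Measurable h) (α : ℝ≥0∞), MeasurableSet {x | α < h x} :=
    fun hh α => measurableSet_lt measurable_const hh
  -- For `r = p` the distribution function enters to the first power, so the dyadic sum is an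
  -- integral over `X` comparable to `∫ h^p`.
  have hint : ∀ {h : X → ℝ≥0∞} (_ : Measurable h),
      ∑' j : ℤ, (2 : ℝ≥0∞) ^ ((j : ℝ) * p.toReal) * distrib μ h (2 ^ (j : ℝ))
        = ∫⁻ x, ∑' j : ℤ, 2 ^ ((j : ℝ) * p.toReal) * truthValue (2 ^ (j : ℝ) < h x) ∂μ := by
    intro h hh
    rw [lintegral_tsum fun i => ((measurable_truthValue (hms hh _)).const_mul _).aemeasurable]
    congr with j
    rw [lintegral_const_mul' _ _ (two_rpow_ne_top _), lintegral_truthValue μ (hms hh _)]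
    rfl
  have hup : ∀ k, lorentzNorm μ p p (F k) ^ p.toReal
      ≤ 2 ^ p.toReal * (D * ∫⁻ x, F k x ^ p.toReal ∂μ) := fun k => by
    refine (lorentzNorm_rpow_le_dyadic hp hp' hp hp').trans ?_
    simp only [div_self hP.ne', ENNReal.rpow_one]
    rw [hint (hF k), ← lintegral_const_mul' _ _ hDt]
    gcongr with x
    refine le_trans ?_ (tsum_int_le_rpow hP (F k x))
    gcongr
    exact truthValue_mono le_of_lt
  have hlow : ∫⁻ x, g x ^ p.toReal ∂μ ≤ 2 ^ p.toReal * (D * lorentzNorm μ p p g ^ p.toReal) := by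
    have h1 := dyadic_le_lorentzNorm_rpow (μ := μ) (h := g) hp hp' hp hp'
    simp only [div_self hP.ne', ENNReal.rpow_one] at h1
    refine le_trans ?_ (mul_le_mul_right h1 _)
    rw [hint hg, ← lintegral_const_mul' _ _ (two_rpow_ne_top _)]
    exact lintegral_mono fun x => rpow_le_tsum_int hP (g x)
  rw [div_self hP.ne', ENNReal.rpow_one]
  calc ∑' k, lorentzNorm μ p p (F k) ^ p.toReal
      ≤ ∑' k, 2 ^ p.toReal * (D * ∫⁻ x, F k x ^ p.toReal ∂μ) := ENNReal.tsum_le_tsum hup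
    _ = 2 ^ p.toReal * (D * ∫⁻ x, g x ^ p.toReal ∂μ) := by
        rw [ENNReal.tsum_mul_left, ENNReal.tsum_mul_left,
          ← lintegral_tsum fun k => ((hF k).pow_const _).aemeasurable]
        simp only [hFg]
        rfl
    _ ≤ 2 ^ p.toReal * (D * (2 ^ p.toReal * (D * lorentzNorm μ p p g ^ p.toReal))) := by gcongr
    _ = _ := by ring

/-- The embedding for measurable nonnegative functions. -/
lemma exists_ellNorm_lorentzNorm_le (p q₀ q₁ r₀ r₁ : ℝ≥0∞) (hp : 0 < p) (hp' : p < ∞)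
    (hq₀ : 0 < q₀) (hr₀ : 0 < r₀)
    (hr : r₀ ≤ r₁) (hq : max p (max q₀ r₀) ≤ q₁)
    (hcases : p ≠ q₀ ∨ (p = q₀ ∧ q₀ ≤ r₁) ∨ (r₁ < q₀ ∧ q₀ = p ∧ p < q₁)) :
    ∃ C : ℝ≥0, ∀ (X : Type*) [MeasurableSpace X] (μ : Measure X)
      (ι : Type*) [Countable ι] (F : ι → X → ℝ≥0∞), (∀ k, Measurable (F k)) →
        lorentzNorm μ p r₀ (fun x => ellNorm q₀ fun k => F k x) ≠ ∞ →
        ellNorm q₁ (fun k => lorentzNorm μ p r₁ (F k))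
          ≤ C * lorentzNorm μ p r₀ (fun x => ellNorm q₀ fun k => F k x) := by
  obtain ⟨hpq, hqq, hrq⟩ : p ≤ q₁ ∧ q₀ ≤ q₁ ∧ r₀ ≤ q₁ := by simpa using hq
  have hq₁ : 0 < q₁ := hp.trans_le hpq
  obtain ⟨C, hC⟩ := exists_lorentzNorm_le hp hp'.ne hr₀ hr
  by_cases hq₁' : q₁ = ∞
  · refine ⟨C, fun X _ μ ι _ F hF _ => ?_⟩
    rw [ellNorm, if_pos hq₁']
    refine iSup_le fun k => (hC X μ (F k)).trans ?_
    gcongr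
    exact lorentzNorm_mono fun x => le_ellNorm hq₀ (fun k => F k x) k
  rcases hpq.lt_or_eq with hlt | rfl
  · obtain ⟨C', hC'⟩ := exists_ellNorm_lorentzNorm_le_of_lt hp hr₀ hlt hrq hq₁'
    refine ⟨C * C', fun X _ μ ι _ F hF hN => ?_⟩
    have hg : lorentzNorm μ p r₀ (fun x => ellNorm q₁ fun k => F k x)
        ≤ lorentzNorm μ p r₀ (fun x => ellNorm q₀ fun k => F k x) :=
      lorentzNorm_mono fun x => ellNorm_antitone hq₀ hqq hq₁' _
    refine (ellNorm_mono fun k => hC X μ (F k)).trans ?_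
    rw [ellNorm_const_mul hq₁ hq₁', ENNReal.coe_mul, mul_assoc]
    gcongr
    exact (hC' X μ ι F hF (ne_top_of_le_ne_top hN hg)).trans (by gcongr)
  rcases hqq.lt_or_eq with hlt | rfl
  · obtain ⟨C', hC'⟩ := exists_ellNorm_lorentzNorm_le_of_gt hq₁' hq₀ hr₀ hlt hrq
    refine ⟨C * C', fun X _ μ ι _ F hF hN => ?_⟩
    refine (ellNorm_mono fun k => hC X μ (F k)).trans ?_
    rw [ellNorm_const_mul hq₁ hq₁', ENNReal.coe_mul, mul_assoc]
    gcongr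
    exact hC' X μ ι F hF
  -- Here `q₀ = p = q₁`, the only place where the case distinction matters: it excludes `r₁ < p`.
  · have hqr : q₀ ≤ r₁ := by
      rcases hcases with h | h | h
      · exact absurd rfl h
      · exact h.2
      · exact absurd h.2.2 (lt_irrefl _)
    obtain ⟨C₀, hC₀⟩ := exists_lorentzNorm_le hp hp'.ne hr₀ hrq
    obtain ⟨C₁, hC₁⟩ := exists_lorentzNorm_le hp hp'.ne hp hqr
    obtain ⟨C', hC'⟩ := exists_ellNorm_lorentzNorm_le_of_eq hp hp'.ne
    refine ⟨C₁ * (C' * C₀), fun X _ μ ι _ F hF hN => ?_⟩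
    refine (ellNorm_mono fun k => hC₁ X μ (F k)).trans ?_
    rw [ellNorm_const_mul hq₁ hq₁', ENNReal.coe_mul, ENNReal.coe_mul, mul_assoc, mul_assoc]
    gcongr
    refine (hC' X μ ι F hF).trans ?_
    gcongr
    exact hC₀ X μ _

end LorentzSeq

theorem proposition4p2 (p q₀ q₁ r₀ r₁ : ℝ≥0∞) (hp : 0 < p) (hp' : p < ∞)
    (hq₀ : 0 < q₀) (hq₁ : 0 < q₁) (hr₀ : 0 < r₀) (hr₁ : 0 < r₁)
    (hr : r₀ ≤ r₁) (hq : max p (max q₀ r₀) ≤ q₁)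
    (hcases : p ≠ q₀ ∨ (p = q₀ ∧ q₀ ≤ r₁) ∨ (r₁ < q₀ ∧ q₀ = p ∧ p < q₁)) :
    -- the constant depends on the exponents only
    ∃ C : ℝ≥0, ∀ (X : Type*) [MeasurableSpace X] (μ : Measure X), LorentzSeq.NonAtomic μ →
      ∀ (ι : Type*) [Countable ι] (f : ι → X → ℂ), LorentzSeq.MemLorentzEll μ p r₀ q₀ f →
        LorentzSeq.MemEllLorentz μ p r₁ q₁ f ∧
          LorentzSeq.ellLorentzNorm μ p r₁ q₁ f ≤ C * LorentzSeq.lorentzEllNorm μ p r₀ q₀ f := by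
  obtain ⟨C, hC⟩ := LorentzSeq.exists_ellNorm_lorentzNorm_le p q₀ q₁ r₀ r₁ hp hp' hq₀ hr₀ hr hq
    hcases
  refine ⟨C, fun X _ μ _ ι _ f hf => ?_⟩
  obtain ⟨hmeas, hfin⟩ := hf
  -- Measurable representatives replace the `f k`; countability of `ι` merges the exceptional null
  -- sets into one.
  have hae : ∀ k, (fun x => ‖f k x‖ₑ) =ᵐ[μ] fun x => ‖(hmeas k).mk (f k) x‖ₑ := fun k =>
    (hmeas k).ae_eq_mk.fun_comp enorm
  have hae' : (fun x => LorentzSeq.ellNorm q₀ fun k => ‖f k x‖ₑ)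
      =ᵐ[μ] fun x => LorentzSeq.ellNorm q₀ fun k => ‖(hmeas k).mk (f k) x‖ₑ := by
    filter_upwards [ae_all_iff.2 hae] with x hx
    congr 1
    funext k
    exact hx k
  have key : LorentzSeq.ellLorentzNorm μ p r₁ q₁ f ≤ C * LorentzSeq.lorentzEllNorm μ p r₀ q₀ f := by
    have := hC X μ ι (fun k x => ‖(hmeas k).mk (f k) x‖ₑ)
      (fun k => (hmeas k).measurable_mk.enorm)
      (by rw [← LorentzSeq.lorentzNorm_congr_ae hae']; exact hfin.ne)
    rw [← LorentzSeq.lorentzNorm_congr_ae hae'] at this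
    simp only [← LorentzSeq.lorentzNorm_congr_ae (hae _)] at this
    exact this
  exact ⟨⟨hmeas, key.trans_lt (ENNReal.mul_lt_top ENNReal.coe_lt_top hfin)⟩, key⟩
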